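/- Setting. All events are elements of a complete atomic Boolean algebra with top $\Omega$ (the sure event) and bottom $\emptyset$. For a set $\mathcal G$ of events, $\langle\mathcal G\rangle$ is the Boolean algebra generated by $\mathcal G$, and $\langle\mathcal G\rangle^*$ is the smallest Boolean algebra containing $\mathcal G$ that is closed under arbitrary disjunctions and conjunctions. Let $\mathcal L=\{H_i\}_{i\in I}$ and $\mathcal E=\{E_j\}_{j\in J}$ be two partitions of $\Omega$ (into non-empty events, with arbitrary index sets). Let $\mathcal A_{\mathcal L},\mathcal A_{\mathcal E},\mathcal A$ be Boolean algebras with $\langle\mathcal L\rangle\subseteq\mathcal A_{\mathcal L}\subseteq\langle\mathcal L\rangle^*$, $\langle\mathcal E\rangle\subseteq\mathcal A_{\mathcal E}\subseteq\langle\mathcal E\rangle^*$ and $\langle\mathcal A_{\mathcal L}\cup\mathcal A_{\mathcal E}\rangle\subseteq\mathcal A\subseteq\langle\mathcal A_{\mathcal L}\cup\mathcal A_{\mathcal E}\rangle^*$, and put $\mathcal A^0=\mathcal A\setminus\{\emptyset\}$. Let $\pi$ be a finitely additive probability on $\mathcal A_{\mathcal L}$. Let $\sigma$ be a strategy on $\mathcal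 A\times\mathcal L$, i.e. for every $i\in I$, $\sigma(\cdot|H_i)$ is a finitely additive probability on $\mathcal A$ with $\sigma(F|H_i)=1$ whenever $F\in\mathcal A$ and $F\wedge H_i=H_i$. Assume that for every $F\in\mathcal A$ the function $X=\sigma(F|\cdot):\mathcal L\to[0,1]$ is $\mathcal A_{\mathcal L}$-continuous: for all $t\in\mathbb R$ and $\epsilon>0$ there is $A\in\mathcal A_{\mathcal L}$ with $(X\ge t+\epsilon)\subseteq A\subseteq(X\ge t)$, where $(X\ge t)=\bigvee\{H_i: X(H_i)\ge t\}$. Then for every $F\in\mathcal A$ the function $\sigma(F|\cdot)$ is Stieltjes integrable with respect to $\pi$, i.e. the lower integral $\sup\sum_{u}\big(\inf_{H_i\subseteq A_u}\sigma(F|H_i)\big)\pi(A_u)$ and the upper integral $\inf\sum_{u}\big(\sup_{H_i\subseteq A_u}\sigma(F|H_i)\big)\pi(A_u)$ coincide, where the supremum and the infimum are over the finite partitions $\{A_u\}$ of $\Omega$ contained in $\mathcal A_{\mathcal L}$. Denote the common value by $P^{\mathbf d}(F)=\int\sigma(F|H_i)\,\pi(\mathrm dH_i)$. A full conditional probability on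 $\mathcal A$ is a function $P$ on $\mathcal A\times\mathcal A^0$ such that $P(E|K)=P(E\wedge K|K)$ for all $E\in\mathcal A$ and $K\in\mathcal A^0$; $P(\cdot|K)$ is a finitely additive probability on $\mathcal A$ for all $K\in\mathcal A^0$; and $P(E\wedge F|K)=P(E|K)\,P(F|E\wedge K)$ for all $E,F\in\mathcal A$ and $K,E\wedge K\in\mathcal A^0$. Let $\mathcal P^{\mathbf d}$ be the set of full conditional probabilities $\tilde P$ on $\mathcal A$ extending $\{P^{\mathbf d},\sigma\}$, i.e. $\tilde P(F|\Omega)=P^{\mathbf d}(F)$ and $\tilde P(F|H_i)=\sigma(F|H_i)$ for all $F\in\mathcal A$ and $i\in I$. Theorem. For every $F\in\mathcal A$ and $K\in\mathcal A^0$ the minimum $\underline P^{\mathbf d}(F|K)=\min\{\tilde P(F|K):\tilde P\in\mathcal P^{\mathbf d}\}$ exists (in particular $\mathcal P^{\mathbf d}\ne\emptyset$). It equals $1$ if $F\wedge K=K$. If $F\wedge K\neq K$, then: (i) if $P^{\mathbf d}(K)>0$, then $\underline P^{\mathbf d}(F|K)=\dfrac{P^{\mathbf d}(F\wedge K)}{P^{\mathbf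 d}(K)}$; (ii) if $P^{\mathbf d}(K)=0$, then $$\underline P^{\mathbf d}(F|K)=\begin{cases}\displaystyle\min_{i\in I_2}\frac{\sigma(F\wedge K|H_i)}{\sigma(K|H_i)} & \text{if } I_2\ne\emptyset=I_3,\ I_2 \text{ is finite, and } \sigma(K|H_i)>0 \text{ for all } i\in I_2,\\[2ex] 0 & \text{otherwise,}\end{cases}$$ where $I_2=\{i\in I: H_i\wedge F\wedge K\ne\emptyset\ne H_i\wedge F^c\wedge K\}$ and $I_3=\{i\in I: H_i\wedge F\wedge K=\emptyset\ne H_i\wedge F^c\wedge K\}$. -/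

import Mathlib

noncomputable section

open Set

namespace Envelope

/-- A partition of the sure event `⊤`: an indexed family of pairwise incompatible possible
events whose disjunction is `⊤`. -/
structure IsPartition {𝓑 I : Type*} [CompleteAtomicBooleanAlgebra 𝓑] (H : I → 𝓑) : Prop where
  ne_bot : ∀ i, H i ≠ ⊥
  disjoint : ∀ i j, i ≠ j → Disjoint (H i) (H j)
  iSup_eq_top : ⨆ i, H i = ⊤

/-- `⟨G⟩*`: the smallest subalgebra containing `G` and closed under arbitrary disjunctions and
conjunctions. (Atomicity is automatic: a complete subalgebra of a complete atomic Boolean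
algebra is atomic.) -/
def completeClosure {𝓑 : Type*} [CompleteAtomicBooleanAlgebra 𝓑] (G : Set 𝓑) :
    BooleanSubalgebra 𝓑 :=
  sInf {S | G ⊆ (S : Set 𝓑) ∧ ∀ T : Set 𝓑, T ⊆ (S : Set 𝓑) → sSup T ∈ S ∧ sInf T ∈ S}

/-- `p` (restricted to `A`) is a finitely additive probability on the algebra `A`.
Values of `p` outside `A` are irrelevant. -/
structure IsFinAddProb {𝓑 : Type*} [CompleteAtomicBooleanAlgebra 𝓑]
    (A : BooleanSubalgebra 𝓑) (p : 𝓑 → ℝ) : Prop where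
  nonneg : ∀ F ∈ A, 0 ≤ p F
  top : p ⊤ = 1
  sup_of_disjoint : ∀ F ∈ A, ∀ G ∈ A, Disjoint F G → p (F ⊔ G) = p F + p G

/-- `σ` is a strategy on `A × L`, where `L = {H i}`; `σ F i` is `σ(F | H i)`. -/
structure IsStrategy {𝓑 I : Type*} [CompleteAtomicBooleanAlgebra 𝓑] (H : I → 𝓑)
    (A : BooleanSubalgebra 𝓑) (σ : 𝓑 → I → ℝ) : Prop where
  eq_one : ∀ i, ∀ F ∈ A, F ⊓ H i = H i → σ F i = 1
  finAddProb : ∀ i, IsFinAddProb A (fun F => σ F i)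

/-- `P` (restricted to `A × (A \ {⊥})`) is a full conditional probability on `A`;
`P F K` is `P(F | K)`. Values outside `A × (A \ {⊥})` are irrelevant. -/
structure IsFullCondProb {𝓑 : Type*} [CompleteAtomicBooleanAlgebra 𝓑]
    (A : BooleanSubalgebra 𝓑) (P : 𝓑 → 𝓑 → ℝ) : Prop where
  inf_self : ∀ F ∈ A, ∀ K ∈ A, K ≠ ⊥ → P F K = P (F ⊓ K) K
  finAddProb : ∀ K ∈ A, K ≠ ⊥ → IsFinAddProb A (fun F => P F K)
  chain : ∀ E ∈ A, ∀ F ∈ A, ∀ K ∈ A, K ≠ ⊥ → E ⊓ K ≠ ⊥ →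
    P (E ⊓ F) K = P E K * P F (E ⊓ K)

/-- The lower Stieltjes integral of `X : L → ℝ`, the supremum of the lower sums over all finite
partitions of `⊤` contained in `AL`. -/
def lowerIntegral {𝓑 I : Type*} [CompleteAtomicBooleanAlgebra 𝓑] (H : I → 𝓑)
    (AL : BooleanSubalgebra 𝓑) (π : 𝓑 → ℝ) (X : I → ℝ) : ℝ :=
  sSup {s | ∃ p : Finpartition (⊤ : 𝓑), (∀ B ∈ p.parts, B ∈ AL) ∧
    s = ∑ B ∈ p.parts, sInf (X '' {i | H i ≤ B}) * π B}

/-- The upper Stieltjes integral of `X : L → ℝ`. -/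
def upperIntegral {𝓑 I : Type*} [CompleteAtomicBooleanAlgebra 𝓑] (H : I → 𝓑)
    (AL : BooleanSubalgebra 𝓑) (π : 𝓑 → ℝ) (X : I → ℝ) : ℝ :=
  sInf {s | ∃ p : Finpartition (⊤ : 𝓑), (∀ B ∈ p.parts, B ∈ AL) ∧
    s = ∑ B ∈ p.parts, sSup (X '' {i | H i ≤ B}) * π B}

/-- Stieltjes integrability (of a bounded function `X`): the lower and the upper integral
coincide. -/
def IsSIntegrable {𝓑 I : Type*} [CompleteAtomicBooleanAlgebra 𝓑] (H : I → 𝓑)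
    (AL : BooleanSubalgebra 𝓑) (π : 𝓑 → ℝ) (X : I → ℝ) : Prop :=
  lowerIntegral H AL π X = upperIntegral H AL π X

/-- The Stieltjes integral of an S-integrable `X`: the common value of the lower and the upper
integral. -/
def integral {𝓑 I : Type*} [CompleteAtomicBooleanAlgebra 𝓑] (H : I → 𝓑)
    (AL : BooleanSubalgebra 𝓑) (π : 𝓑 → ℝ) (X : I → ℝ) : ℝ :=
  lowerIntegral H AL π X

/-- The event `(X ≥ t)`. -/
def geEvent {𝓑 I : Type*} [CompleteAtomicBooleanAlgebra 𝓑] (H : I → 𝓑) (X : I → ℝ) (t : ℝ) : 𝓑 :=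
  sSup (H '' {i | t ≤ X i})

/-- `X : L → ℝ` is `AL`-continuous. -/
structure IsAlgContinuous {𝓑 I : Type*} [CompleteAtomicBooleanAlgebra 𝓑] (H : I → 𝓑)
    (AL : BooleanSubalgebra 𝓑) (X : I → ℝ) : Prop where
  bounded : ∃ C : ℝ, ∀ i, |X i| ≤ C
  exists_between : ∀ t ε : ℝ, 0 < ε →
    ∃ B ∈ AL, geEvent H X (t + ε) ≤ B ∧ B ≤ geEvent H X t

/-- The `L`-disintegrable joint probability `P^d(F) = ∫ σ(F | H i) π(dH i)`. -/
def disintegrableJoint {𝓑 I : Type*} [CompleteAtomicBooleanAlgebra 𝓑] (H : I → 𝓑)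
    (AL : BooleanSubalgebra 𝓑) (π : 𝓑 → ℝ) (σ : 𝓑 → I → ℝ) (F : 𝓑) : ℝ :=
  integral H AL π (σ F)

/-- The set of full conditional probabilities on `A` that extend `{Pd, σ}`: they agree with `Pd`
on `A × {⊤}` and with `σ` on `A × L`. -/
def extensions {𝓑 I : Type*} [CompleteAtomicBooleanAlgebra 𝓑] (H : I → 𝓑)
    (A : BooleanSubalgebra 𝓑) (Pd : 𝓑 → ℝ) (σ : 𝓑 → I → ℝ) : Set (𝓑 → 𝓑 → ℝ) :=
  {P | IsFullCondProb A P ∧ (∀ F ∈ A, P F ⊤ = Pd F) ∧ ∀ F ∈ A, ∀ i, P F (H i) = σ F i}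

/-- The pointwise lower envelope of a set of (conditional) probabilities. -/
def lowerEnvelope {𝓑 : Type*} (𝓟 : Set (𝓑 → 𝓑 → ℝ)) (F K : 𝓑) : ℝ :=
  sInf ((fun P => P F K) '' 𝓟)

/-- `I₂^{F|K}`: the indices `i` with `H i ∧ F ∧ K ≠ ⊥ ≠ H i ∧ Fᶜ ∧ K`. -/
def I₂ {𝓑 I : Type*} [CompleteAtomicBooleanAlgebra 𝓑] (H : I → 𝓑) (F K : 𝓑) : Set I :=
  {i | H i ⊓ F ⊓ K ≠ ⊥ ∧ H i ⊓ Fᶜ ⊓ K ≠ ⊥}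

/-- `I₃^{F|K}`: the indices `i` with `H i ∧ F ∧ K = ⊥ ≠ H i ∧ Fᶜ ∧ K`. -/
def I₃ {𝓑 I : Type*} [CompleteAtomicBooleanAlgebra 𝓑] (H : I → 𝓑) (F K : 𝓑) : Set I :=
  {i | H i ⊓ F ⊓ K = ⊥ ∧ H i ⊓ Fᶜ ⊓ K ≠ ⊥}

/-- The condition under which the envelope at a conditioning event of probability zero is given
by the minimum of ratios. -/
def RatioCase {𝓑 I : Type*} [CompleteAtomicBooleanAlgebra 𝓑] (H : I → 𝓑) (σ : 𝓑 → I → ℝ)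
    (F K : 𝓑) : Prop :=
  (I₂ H F K).Nonempty ∧ I₃ H F K = ∅ ∧ (I₂ H F K).Finite ∧ ∀ i ∈ I₂ H F K, 0 < σ K i

end Envelope

end

namespace Envelope

open Set Filter

variable {𝓑 I : Type*} [CompleteAtomicBooleanAlgebra 𝓑] {H : I → 𝓑}
  {AL A : BooleanSubalgebra 𝓑} {π p Pd : 𝓑 → ℝ} {X Y Z : I → ℝ} {σ : 𝓑 → I → ℝ}

/-! ### Events logically dependent on a partition -/

/-! A full conditional probability can be built from layers: condition by Bayes' rule in the first
layer that charges the conditioning event. Placing a probability `μ` in front of an extension of `σ`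
again extends `σ` as soon as `μ (F ⊓ H i) = σ F i * μ (H i)` (`consCond_apply_eq`). The joint `Pd`
satisfies this (`disintegrableJoint_inf`), so it can always be the first layer; the second is free,
and it decides on the events that are null for `Pd` and charged by it.

If `Pd K > 0`, the chain rule forces the Bayes ratio. If `Pd K = 0`, in the ratio case `Fᶜ ⊓ K` is
covered by finitely many `H i`, and finite additivity with the chain rule bounds `P Fᶜ K` by an
average of the conditional probabilities of `Fᶜ` given `H i ⊓ K` (`RatioCase.le_of_mem_extensions`);
the layer `σ(· | H i)` at a minimizing `i` attains the bound. Otherwise the value zero is reached by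
a layer `σ(· | H i)` not charging `F ⊓ K`, by a point mass at an atom of `Fᶜ ⊓ K` behind `σ(· | H
i)`, or, for infinite `I₂`, by a nonprincipal two-valued probability that vanishes on every `H j`.

The integral is handled by uniform approximation: algebra-continuous functions are uniform limits of
simple functions. -/

lemma IsPartition.le_or_disjoint (hH : IsPartition H)
    (hAL' : AL ≤ completeClosure (range H)) {B : 𝓑} (hB : B ∈ AL) (i : I) :
    H i ≤ B ∨ Disjoint (H i) B := by
  -- The events that contain or miss the fixed `H i` form an algebra closed under arbitrary joins
  -- and meets.
  let S : BooleanSubalgebra 𝓑 :=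
    { carrier := {B | H i ≤ B ∨ Disjoint (H i) B}
      supClosed' := by
        rintro a (ha | ha) b (hb | hb)
        · exact Or.inl (ha.trans le_sup_left)
        · exact Or.inl (ha.trans le_sup_left)
        · exact Or.inl (hb.trans le_sup_right)
        · exact Or.inr (ha.sup_right hb)
      infClosed' := by
        rintro a (ha | ha) b (hb | hb)
        · exact Or.inl (le_inf ha hb)
        · exact Or.inr (hb.mono_right inf_le_right)
        · exact Or.inr (ha.mono_right inf_le_left)
        · exact Or.inr (ha.mono_right inf_le_left)
      compl_mem' := by
        rintro a (ha | ha)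
        · exact Or.inr (disjoint_compl_right_iff.2 ha)
        · exact Or.inl ha.le_compl_right
      bot_mem' := Or.inr disjoint_bot_right }
  have hS : completeClosure (range H) ≤ S := by
    refine sInf_le ⟨?_, fun T hT => ⟨?_, ?_⟩⟩
    · rintro _ ⟨j, rfl⟩
      by_cases h : i = j
      · exact Or.inl (h ▸ le_rfl)
      · exact Or.inr (hH.disjoint i j h)
    · by_cases h : ∃ B ∈ T, H i ≤ B
      · obtain ⟨B, hB, h⟩ := h
        exact Or.inl (h.trans (le_sSup hB))
      · push Not at h
        exact Or.inr (disjoint_sSup_iff.2 fun B hB => (hT hB).resolve_left (h B hB))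
    · by_cases h : ∃ B ∈ T, Disjoint (H i) B
      · obtain ⟨B, hB, h⟩ := h
        exact Or.inr (h.mono_right (sInf_le hB))
      · push Not at h
        exact Or.inl (le_sInf fun B hB => (hT hB).resolve_right (h B hB))
  exact hS (hAL' hB)

lemma IsPartition.exists_inf_ne_bot (hH : IsPartition H) {B : 𝓑} (hB : B ≠ ⊥) :
    ∃ i, H i ⊓ B ≠ ⊥ := by
  by_contra! h
  apply hB
  have : (⨆ i, H i) ⊓ B = ⊥ := by simp [iSup_inf_eq, h]
  rwa [hH.iSup_eq_top, top_inf_eq] at this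

lemma IsPartition.exists_le (hH : IsPartition H) (hAL' : AL ≤ completeClosure (range H))
    {B : 𝓑} (hB : B ∈ AL) (hB0 : B ≠ ⊥) : ∃ i, H i ≤ B := by
  obtain ⟨i, hi⟩ := hH.exists_inf_ne_bot hB0
  exact ⟨i, (hH.le_or_disjoint hAL' hB i).resolve_right fun h => hi h.eq_bot⟩

lemma IsPartition.le_of_le_geEvent (hH : IsPartition H) {B : 𝓑} {t : ℝ}
    (hB : B ≤ geEvent H X t) {i : I} (hi : H i ≤ B) : t ≤ X i := by
  by_contra h
  refine hH.ne_bot i (disjoint_self.1 (Disjoint.mono_right (hi.trans hB) ?_))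
  rw [geEvent, disjoint_sSup_iff]
  rintro _ ⟨j, hj, rfl⟩
  exact hH.disjoint i j (by rintro rfl; exact h hj)

lemma le_geEvent {i : I} {t : ℝ} (h : t ≤ X i) : H i ≤ geEvent H X t :=
  le_sSup (mem_image_of_mem _ h)

/-! ### Finitely additive probabilities -/

namespace IsFinAddProb

lemma bot (hp : IsFinAddProb A p) : p ⊥ = 0 := by
  have := hp.sup_of_disjoint ⊥ A.bot_mem' ⊥ A.bot_mem' disjoint_bot_left
  simp at this
  exact this

lemma mono (hp : IsFinAddProb A p) {F G : 𝓑} (hF : F ∈ A) (hG : G ∈ A) (h : F ≤ G) :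
    p F ≤ p G := by
  have hd := BooleanSubalgebra.sdiff_mem hG hF
  have := hp.sup_of_disjoint F hF (G \ F) hd disjoint_sdiff_self_right
  rw [sup_sdiff_cancel_right h] at this
  linarith [hp.nonneg _ hd]

lemma le_one (hp : IsFinAddProb A p) {F : 𝓑} (hF : F ∈ A) : p F ≤ 1 :=
  hp.top ▸ hp.mono hF BooleanSubalgebra.top_mem le_top

/-- Localised at `B` so as to serve both common refinements of partitions and the splitting of `Fᶜ`
over finitely many `H i`. -/
lemma sum_inf {ι : Type*} (hp : IsFinAddProb A p) {B : 𝓑} (hB : B ∈ A) (s : Finset ι)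
    {f : ι → 𝓑} (hs : ∀ i ∈ s, f i ∈ A) (hd : (s : Set ι).PairwiseDisjoint f) :
    s.sup f ∈ A ∧ ∑ i ∈ s, p (B ⊓ f i) = p (B ⊓ s.sup f) := by
  classical
  induction s using Finset.induction_on with
  | empty => simp [hp.bot]
  | insert C s hC ih =>
    have hCA := hs C (Finset.mem_insert_self _ _)
    obtain ⟨h1, h2⟩ := ih (fun D hD => hs D (Finset.mem_insert_of_mem hD))
      (hd.subset (by simp))
    have hdis : Disjoint (f C) (s.sup f) := by
      rw [Finset.disjoint_sup_right]
      intro D hD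
      exact hd (by simp) (by simp [hD]) (by rintro rfl; exact hC hD)
    rw [Finset.sum_insert hC, Finset.sup_insert, h2, inf_sup_left]
    exact ⟨BooleanSubalgebra.sup_mem hCA h1,
      (hp.sup_of_disjoint _ (A.infClosed hB hCA) _ (A.infClosed hB h1)
        (hdis.mono inf_le_right inf_le_right)).symm⟩

lemma sum_parts (hp : IsFinAddProb A p) {B : 𝓑} (hB : B ∈ A) (P : Finpartition (⊤ : 𝓑))
    (hP : ∀ C ∈ P.parts, C ∈ A) : ∑ C ∈ P.parts, p (B ⊓ C) = p B := by
  simpa [P.sup_parts] using (hp.sum_inf (f := id) hB P.parts hP P.disjoint).2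

lemma sum_parts_eq_one (hp : IsFinAddProb A p) (P : Finpartition (⊤ : 𝓑))
    (hP : ∀ C ∈ P.parts, C ∈ A) : ∑ C ∈ P.parts, p C = 1 := by
  simpa [hp.top] using hp.sum_parts BooleanSubalgebra.top_mem P hP

lemma inf_add_inf_compl (hp : IsFinAddProb A p) {F K : 𝓑} (hF : F ∈ A) (hK : K ∈ A) :
    p (F ⊓ K) + p (Fᶜ ⊓ K) = p K := by
  rw [← hp.sup_of_disjoint _ (A.infClosed hF hK) _
    (A.infClosed (BooleanSubalgebra.compl_mem hF) hK)
    (disjoint_compl_right.mono inf_le_left inf_le_left), ← inf_sup_right, sup_compl_eq_top,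
    top_inf_eq]

end IsFinAddProb

/-! ### Stieltjes integral -/

/-- The integrals of three simple functions with nonnegative sum have a nonnegative sum. -/
lemma sum_nonneg_of_pointwise (hH : IsPartition H) (hAL' : AL ≤ completeClosure (range H))
    (hπ : IsFinAddProb AL π) (p q r : Finpartition (⊤ : 𝓑)) (hp : ∀ B ∈ p.parts, B ∈ AL)
    (hq : ∀ B ∈ q.parts, B ∈ AL) (hr : ∀ B ∈ r.parts, B ∈ AL) (x y z : 𝓑 → ℝ)
    (h : ∀ i, ∀ B ∈ p.parts, ∀ C ∈ q.parts, ∀ D ∈ r.parts, H i ≤ B → H i ≤ C → H i ≤ D →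
      0 ≤ x B + y C + z D) :
    0 ≤ ∑ B ∈ p.parts, x B * π B + ∑ C ∈ q.parts, y C * π C + ∑ D ∈ r.parts, z D * π D := by
  -- All three sums are rewritten over the common refinement. A nonzero cell contains some `H i`,
  -- where the pointwise hypothesis applies; a zero cell has weight zero.
  have key : ∀ (p q r : Finpartition (⊤ : 𝓑)), (∀ B ∈ p.parts, B ∈ AL) →
      (∀ B ∈ q.parts, B ∈ AL) → (∀ B ∈ r.parts, B ∈ AL) → ∀ x : 𝓑 → ℝ,
      ∑ B ∈ p.parts, x B * π B =
        ∑ B ∈ p.parts, ∑ C ∈ q.parts, ∑ D ∈ r.parts, x B * π (B ⊓ C ⊓ D) := by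
    intro p q r hp hq hr x
    refine Finset.sum_congr rfl fun B hB => ?_
    rw [← hπ.sum_parts (hp B hB) q hq, Finset.mul_sum]
    refine Finset.sum_congr rfl fun C hC => ?_
    rw [← hπ.sum_parts (AL.infClosed (hp B hB) (hq C hC)) r hr, Finset.mul_sum]
  have hy : ∑ C ∈ q.parts, y C * π C =
      ∑ B ∈ p.parts, ∑ C ∈ q.parts, ∑ D ∈ r.parts, y C * π (B ⊓ C ⊓ D) := by
    rw [key q p r hq hp hr y, Finset.sum_comm]
    simp only [inf_comm]
  have hz : ∑ D ∈ r.parts, z D * π D =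
      ∑ B ∈ p.parts, ∑ C ∈ q.parts, ∑ D ∈ r.parts, z D * π (B ⊓ C ⊓ D) := by
    rw [key r p q hr hp hq z, Finset.sum_comm]
    refine Finset.sum_congr rfl fun B _ => ?_
    rw [Finset.sum_comm]
    refine Finset.sum_congr rfl fun C _ => Finset.sum_congr rfl fun D _ => ?_
    rw [inf_assoc, inf_comm D]
  rw [key p q r hp hq hr x, hy, hz]
  simp only [← Finset.sum_add_distrib, ← add_mul]
  refine Finset.sum_nonneg fun B hB => Finset.sum_nonneg fun C hC =>
    Finset.sum_nonneg fun D hD => ?_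
  have hm := AL.infClosed (AL.infClosed (hp B hB) (hq C hC)) (hr D hD)
  by_cases h0 : B ⊓ C ⊓ D = ⊥
  · rw [h0, hπ.bot, mul_zero]
  · obtain ⟨i, hi⟩ := hH.exists_le hAL' hm h0
    simp only [le_inf_iff] at hi
    exact mul_nonneg (h i B hB C hC D hD hi.1.1 hi.1.2 hi.2) (hπ.nonneg _ hm)

/-- `X` has integral `c`: it is approximated uniformly by simple functions whose integrals
approximate `c`. -/
def HasIntegral (H : I → 𝓑) (AL : BooleanSubalgebra 𝓑) (π : 𝓑 → ℝ) (X : I → ℝ) (c : ℝ) : Prop :=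
  ∀ ε : ℝ, 0 < ε → ∃ (p : Finpartition (⊤ : 𝓑)) (x : 𝓑 → ℝ), (∀ B ∈ p.parts, B ∈ AL) ∧
    (∀ B ∈ p.parts, ∀ i, H i ≤ B → |X i - x B| ≤ ε) ∧ |c - ∑ B ∈ p.parts, x B * π B| ≤ ε

namespace HasIntegral

/-- Positivity, normalisation, additivity and homogeneity of the joint all follow from this one
inequality, an equality being two applications with opposite signs. -/
lemma add_add_nonneg (hH : IsPartition H) (hAL' : AL ≤ completeClosure (range H))
    (hπ : IsFinAddProb AL π) {a b c : ℝ} (hX : HasIntegral H AL π X a)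
    (hY : HasIntegral H AL π Y b) (hZ : HasIntegral H AL π Z c)
    (h : ∀ i, 0 ≤ X i + Y i + Z i) : 0 ≤ a + b + c := by
  refine le_of_forall_pos_le_add fun ε hε => ?_
  -- Six errors of `ε / 6`: three pointwise, absorbed by adding `ε / 2` to `x`, and three in the
  -- integrals.
  obtain ⟨p, x, hp, hx, hx'⟩ := hX (ε / 6) (by positivity)
  obtain ⟨q, y, hq, hy, hy'⟩ := hY (ε / 6) (by positivity)
  obtain ⟨r, z, hr, hz, hz'⟩ := hZ (ε / 6) (by positivity)
  have := sum_nonneg_of_pointwise hH hAL' hπ p q r hp hq hr (fun B => x B + ε / 2) y z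
    (by
      intro i B hB C hC D hD h1 h2 h3
      have h1 := abs_le.1 (hx B hB i h1)
      have h2 := abs_le.1 (hy C hC i h2)
      have h3 := abs_le.1 (hz D hD i h3)
      linarith [h i, h1.1, h1.2, h2.1, h2.2, h3.1, h3.2])
  simp only [add_mul, Finset.sum_add_distrib, ← Finset.mul_sum,
    hπ.sum_parts_eq_one p hp] at this
  rw [abs_le] at hx' hy' hz'
  linarith [hx'.1, hy'.1, hz'.1]

lemma const (hπ : IsFinAddProb AL π) (hT : (⊤ : 𝓑) ≠ ⊥) (c : ℝ) :
    HasIntegral H AL π (fun _ => c) c := by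
  intro ε hε
  refine ⟨Finpartition.indiscrete hT, fun _ => c, ?_, ?_, ?_⟩
  · simp
  · simp [hε.le]
  · simp [hπ.top, hε.le]

lemma smul {c : ℝ} (hX : HasIntegral H AL π X c) (a : ℝ) :
    HasIntegral H AL π (fun i => a * X i) (a * c) := by
  intro ε hε
  -- The added `1` keeps the divisor positive when `a = 0`.
  have ha : 0 < |a| + 1 := by positivity
  obtain ⟨p, x, hp, hx, hx'⟩ := hX (ε / (|a| + 1)) (by positivity)
  have key : ∀ u : ℝ, |u| ≤ ε / (|a| + 1) → |a * u| ≤ ε := fun u hu => by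
    rw [abs_mul]
    calc |a| * |u| ≤ (|a| + 1) * (ε / (|a| + 1)) := by gcongr; linarith
      _ = ε := by field_simp
  refine ⟨p, fun B => a * x B, hp, fun B hB i hi => ?_, ?_⟩
  · rw [← mul_sub]
    exact key _ (hx B hB i hi)
  · simp only [mul_assoc, ← Finset.mul_sum]
    rw [← mul_sub]
    exact key _ hx'

/-- If a bounded function has integral `c`, its lower and its upper integral are both `c`. -/
lemma lowerIntegral_eq_and_upperIntegral_eq (hH : IsPartition H)
    (hAL' : AL ≤ completeClosure (range H)) (hπ : IsFinAddProb AL π)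
    (hb : ∃ C : ℝ, ∀ i, |X i| ≤ C) {c : ℝ} (hX : HasIntegral H AL π X c) :
    lowerIntegral H AL π X = c ∧ upperIntegral H AL π X = c := by
  obtain ⟨M, hM⟩ := hb
  have hbb : ∀ B : 𝓑, BddBelow (X '' {i | H i ≤ B}) := fun B =>
    ⟨-M, by rintro _ ⟨i, _, rfl⟩; exact (abs_le.1 (hM i)).1⟩
  have hba : ∀ B : 𝓑, BddAbove (X '' {i | H i ≤ B}) := fun B =>
    ⟨M, by rintro _ ⟨i, _, rfl⟩; exact (abs_le.1 (hM i)).2⟩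
  -- Each part contains some `H i`, so no infimum or supremum falls back on the default value at the
  -- empty set.
  have hne : ∀ P : Finpartition (⊤ : 𝓑), (∀ B ∈ P.parts, B ∈ AL) → ∀ B ∈ P.parts,
      (X '' {i | H i ≤ B}).Nonempty := fun P hP B hB =>
    (hH.exists_le hAL' (hP B hB) (P.ne_bot hB)).elim fun i hi => ⟨X i, i, hi, rfl⟩
  have low : ∀ P : Finpartition (⊤ : 𝓑), (∀ B ∈ P.parts, B ∈ AL) →
      ∑ B ∈ P.parts, sInf (X '' {i | H i ≤ B}) * π B ≤ c := by
    intro P hP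
    refine le_of_forall_pos_le_add fun ε hε => ?_
    obtain ⟨p, x, hp, hx, hx'⟩ := hX (ε / 2) (by positivity)
    have := sum_nonneg_of_pointwise hH hAL' hπ p P P hp hP hP (fun B => x B + ε / 2)
      (fun B => -sInf (X '' {i | H i ≤ B})) (fun _ => 0) (by
        intro i B hB C hC D hD h1 h2 h3
        have h1 := abs_le.1 (hx B hB i h1)
        have h2 := csInf_le (hbb C) (mem_image_of_mem X h2)
        linarith [h1.2])
    simp only [add_mul, Finset.sum_add_distrib, ← Finset.mul_sum, neg_mul, zero_mul,
      Finset.sum_const_zero, Finset.sum_neg_distrib, hπ.sum_parts_eq_one p hp] at this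
    linarith [(abs_le.1 hx').1]
  have upp : ∀ P : Finpartition (⊤ : 𝓑), (∀ B ∈ P.parts, B ∈ AL) →
      c ≤ ∑ B ∈ P.parts, sSup (X '' {i | H i ≤ B}) * π B := by
    intro P hP
    refine le_of_forall_pos_le_add fun ε hε => ?_
    obtain ⟨p, x, hp, hx, hx'⟩ := hX (ε / 2) (by positivity)
    have := sum_nonneg_of_pointwise hH hAL' hπ p P P hp hP hP (fun B => -x B + ε / 2)
      (fun B => sSup (X '' {i | H i ≤ B})) (fun _ => 0) (by
        intro i B hB C hC D hD h1 h2 h3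
        have h1 := abs_le.1 (hx B hB i h1)
        have h2 := le_csSup (hba C) (mem_image_of_mem X h2)
        linarith [h1.1])
    simp only [add_mul, Finset.sum_add_distrib, ← Finset.mul_sum, neg_mul, zero_mul,
      Finset.sum_const_zero, Finset.sum_neg_distrib, hπ.sum_parts_eq_one p hp] at this
    linarith [(abs_le.1 hx').2]
  have approx : ∀ ε : ℝ, 0 < ε → ∃ P : Finpartition (⊤ : 𝓑), (∀ B ∈ P.parts, B ∈ AL) ∧
      c - ε ≤ ∑ B ∈ P.parts, sInf (X '' {i | H i ≤ B}) * π B ∧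
      ∑ B ∈ P.parts, sSup (X '' {i | H i ≤ B}) * π B ≤ c + ε := by
    intro ε hε
    obtain ⟨p, x, hp, hx, hx'⟩ := hX (ε / 2) (by positivity)
    rw [abs_le] at hx'
    refine ⟨p, hp, ?_, ?_⟩
    · have : ∑ B ∈ p.parts, (x B - ε / 2) * π B ≤
          ∑ B ∈ p.parts, sInf (X '' {i | H i ≤ B}) * π B := by
        refine Finset.sum_le_sum fun B hB => mul_le_mul_of_nonneg_right ?_ (hπ.nonneg _ (hp B hB))
        refine le_csInf (hne p hp B hB) ?_
        rintro _ ⟨i, hi, rfl⟩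
        linarith [(abs_le.1 (hx B hB i hi)).1]
      simp only [sub_mul, Finset.sum_sub_distrib, ← Finset.mul_sum,
        hπ.sum_parts_eq_one p hp] at this
      linarith [hx'.2]
    · have : ∑ B ∈ p.parts, sSup (X '' {i | H i ≤ B}) * π B ≤
          ∑ B ∈ p.parts, (x B + ε / 2) * π B := by
        refine Finset.sum_le_sum fun B hB => mul_le_mul_of_nonneg_right ?_ (hπ.nonneg _ (hp B hB))
        refine csSup_le (hne p hp B hB) ?_
        rintro _ ⟨i, hi, rfl⟩
        linarith [(abs_le.1 (hx B hB i hi)).2]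
      simp only [add_mul, Finset.sum_add_distrib, ← Finset.mul_sum,
        hπ.sum_parts_eq_one p hp] at this
      linarith [hx'.1]
  obtain ⟨P₀, hP₀, _⟩ := approx 1 one_pos
  constructor
  · refine le_antisymm (csSup_le ⟨_, P₀, hP₀, rfl⟩ ?_) (le_of_forall_pos_le_add fun ε hε => ?_)
    · rintro _ ⟨P, hP, rfl⟩
      exact low P hP
    · obtain ⟨P, hP, h1, -⟩ := approx ε hε
      have : _ ≤ lowerIntegral H AL π X :=
        le_csSup ⟨c, by rintro _ ⟨P, hP, rfl⟩; exact low P hP⟩ ⟨P, hP, rfl⟩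
      linarith
  · refine le_antisymm (le_of_forall_pos_le_add fun ε hε => ?_) (le_csInf ⟨_, P₀, hP₀, rfl⟩ ?_)
    · obtain ⟨P, hP, -, h1⟩ := approx ε hε
      have : upperIntegral H AL π X ≤ _ :=
        csInf_le ⟨c, by rintro _ ⟨P, hP, rfl⟩; exact upp P hP⟩ ⟨P, hP, rfl⟩
      linarith
    · rintro _ ⟨P, hP, rfl⟩
      exact upp P hP

end HasIntegral

/-- An algebra-continuous function has oscillation at most `ε` on the parts of a finite
partition. -/
lemma IsAlgContinuous.exists_finpartition (hH : IsPartition H)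
    (hX : IsAlgContinuous H AL X) {ε : ℝ} (hε : 0 < ε) :
    ∃ p : Finpartition (⊤ : 𝓑), (∀ B ∈ p.parts, B ∈ AL) ∧
      ∀ B ∈ p.parts, ∀ i j, H i ≤ B → H j ≤ B → X i ≤ X j + ε := by
  classical
  obtain ⟨M, hM⟩ := hX.bounded
  have step : ∀ (n : ℕ) (D : 𝓑), D ∈ AL → (∀ i, H i ≤ D → X i ≤ -M + n * (ε / 2)) →
      ∃ p : Finpartition D, (∀ B ∈ p.parts, B ∈ AL) ∧
        ∀ B ∈ p.parts, ∀ i j, H i ≤ B → H j ≤ B → X i ≤ X j + ε := by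
    intro n
    induction n with
    | zero =>
      intro D hD h
      by_cases h0 : D = ⊥
      · subst h0
        exact ⟨Finpartition.empty 𝓑, by simp, by simp⟩
      · refine ⟨Finpartition.indiscrete h0, by simpa using hD, ?_⟩
        simp only [Finpartition.indiscrete_parts, Finset.mem_singleton, forall_eq]
        intro i j hi hj
        have h1 := h i hi
        have h2 := (abs_le.1 (hM j)).1
        simp only [Nat.cast_zero, zero_mul, add_zero] at h1
        linarith
    | succ n ih =>
      intro D hD h
      -- With `s = -M + n * (ε / 2)`, the event `B` lies between `(X ≥ s)` and `(X ≥ s - ε / 2)`. On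
      -- `D ⊓ B` the values lie in `[s - ε / 2, s + ε / 2]`; on `D \ B` they are below `s`, so the
      -- induction continues there.
      obtain ⟨B, hB, hB1, hB2⟩ := hX.exists_between (-M + n * (ε / 2) - ε / 2) (ε / 2)
        (by positivity)
      rw [sub_add_cancel] at hB1
      obtain ⟨p, hp, hp'⟩ := ih (D \ B) (BooleanSubalgebra.sdiff_mem hD hB) (by
        intro i hi
        by_contra! hlt
        refine hH.ne_bot i (disjoint_self.1 ?_)
        exact (disjoint_sdiff_self_left (x := B) (y := D)).mono hi
          ((le_geEvent hlt.le).trans hB1))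
      by_cases h0 : D ⊓ B = ⊥
      · have : D \ B = D := (disjoint_iff.2 h0).sdiff_eq_left
        exact ⟨p.copy this, by simpa using hp, by simpa using hp'⟩
      · refine ⟨p.extend h0 ((disjoint_sdiff_self_left (x := B) (y := D)).mono_right inf_le_right)
          (by rw [sup_comm, sup_inf_sdiff]), ?_, ?_⟩
        · simp only [Finpartition.extend_parts, Finset.mem_insert, forall_eq_or_imp]
          exact ⟨AL.infClosed hD hB, hp⟩
        · simp only [Finpartition.extend_parts, Finset.mem_insert, forall_eq_or_imp]
          refine ⟨fun i j hi hj => ?_, hp'⟩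
          have h1 := h i (hi.trans inf_le_left)
          have h2 := hH.le_of_le_geEvent hB2 (hj.trans inf_le_right)
          push_cast at h1
          linarith
  obtain ⟨n, hn⟩ := exists_nat_ge (2 * M / (ε / 2))
  rw [div_le_iff₀ (by positivity)] at hn
  exact step n ⊤ BooleanSubalgebra.top_mem fun i _ => by linarith [(abs_le.1 (hM i)).2]

lemma IsAlgContinuous.hasIntegral (hH : IsPartition H)
    (hAL' : AL ≤ completeClosure (range H)) (hπ : IsFinAddProb AL π)
    (hX : IsAlgContinuous H AL X) : HasIntegral H AL π X (lowerIntegral H AL π X) := by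
  obtain ⟨M, hM⟩ := hX.bounded
  have hbb : ∀ B : 𝓑, BddBelow (X '' {i | H i ≤ B}) := fun B =>
    ⟨-M, by rintro _ ⟨i, _, rfl⟩; exact (abs_le.1 (hM i)).1⟩
  -- A lower sum over a partition of oscillation at most `ε` is within `ε` of dominating every other
  -- lower sum; this gives both boundedness of the supremum and the approximation.
  have cmp : ∀ ε : ℝ, 0 < ε → ∀ p : Finpartition (⊤ : 𝓑), (∀ B ∈ p.parts, B ∈ AL) →
      (∀ B ∈ p.parts, ∀ i, H i ≤ B → |X i - sInf (X '' {i | H i ≤ B})| ≤ ε) →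
      ∀ q : Finpartition (⊤ : 𝓑), (∀ B ∈ q.parts, B ∈ AL) →
      ∑ B ∈ q.parts, sInf (X '' {i | H i ≤ B}) * π B ≤
        ∑ B ∈ p.parts, sInf (X '' {i | H i ≤ B}) * π B + ε := by
    intro ε hε p hp hosc q hq
    have := sum_nonneg_of_pointwise hH hAL' hπ p q q hp hq hq
      (fun B => sInf (X '' {i | H i ≤ B}) + ε) (fun B => -sInf (X '' {i | H i ≤ B}))
      (fun _ => 0) (by
        intro i B hB C hC D hD h1 h2 h3
        have h1 := abs_le.1 (hosc B hB i h1)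
        have h2 := csInf_le (hbb C) (mem_image_of_mem X h2)
        linarith [h1.2])
    simp only [add_mul, Finset.sum_add_distrib, ← Finset.mul_sum, neg_mul, zero_mul,
      Finset.sum_const_zero, Finset.sum_neg_distrib, hπ.sum_parts_eq_one p hp] at this
    linarith
  intro ε hε
  obtain ⟨p, hp, hosc⟩ := hX.exists_finpartition hH hε
  have hosc' : ∀ B ∈ p.parts, ∀ i, H i ≤ B → |X i - sInf (X '' {i | H i ≤ B})| ≤ ε := by
    intro B hB i hi
    have h1 := csInf_le (hbb B) (mem_image_of_mem X hi)
    have h2 : X i - ε ≤ sInf (X '' {i | H i ≤ B}) := by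
      refine le_csInf ⟨_, mem_image_of_mem X hi⟩ ?_
      rintro _ ⟨j, hj, rfl⟩
      linarith [hosc B hB i j hi hj]
    rw [abs_le]
    constructor <;> linarith
  refine ⟨p, _, hp, hosc', ?_⟩
  have h1 : _ ≤ lowerIntegral H AL π X := le_csSup
    ⟨_, by rintro _ ⟨q, hq, rfl⟩; exact cmp ε hε p hp hosc' q hq⟩ ⟨p, hp, rfl⟩
  have h2 : lowerIntegral H AL π X ≤ _ := csSup_le ⟨_, p, hp, rfl⟩
    (by rintro _ ⟨q, hq, rfl⟩; exact cmp ε hε p hp hosc' q hq)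
  rw [abs_le]
  constructor <;> linarith

/-! ### Strategies and the disintegrable joint probability -/

lemma IsFinAddProb.top_ne_bot {p : 𝓑 → ℝ} (hp : IsFinAddProb A p) : (⊤ : 𝓑) ≠ ⊥ := by
  intro h
  have := hp.bot
  rw [← h, hp.top] at this
  exact one_ne_zero this

namespace IsStrategy

lemma self (hσ : IsStrategy H A σ) (hHA : ∀ i, H i ∈ A) (i : I) : σ (H i) i = 1 :=
  hσ.eq_one i _ (hHA i) (inf_idem _)

lemma inf_self (hσ : IsStrategy H A σ) (hHA : ∀ i, H i ∈ A) {F : 𝓑} (hF : F ∈ A) (i : I) :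
    σ (F ⊓ H i) i = σ F i := by
  have hi := hσ.finAddProb i
  -- Both totals are `1`, so the termwise inequalities `h3` and `h4` must be equalities.
  have h1 : σ (F ⊓ H i) i + σ (Fᶜ ⊓ H i) i = σ (H i) i := hi.inf_add_inf_compl hF (hHA i)
  have h2 : σ (F ⊓ ⊤) i + σ (Fᶜ ⊓ ⊤) i = σ ⊤ i :=
    hi.inf_add_inf_compl hF BooleanSubalgebra.top_mem
  have h3 : σ (F ⊓ H i) i ≤ σ F i := hi.mono (A.infClosed hF (hHA i)) hF inf_le_left
  have hF' := BooleanSubalgebra.compl_mem hF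
  have h4 : σ (Fᶜ ⊓ H i) i ≤ σ Fᶜ i := hi.mono (A.infClosed hF' (hHA i)) hF' inf_le_left
  have h5 : σ ⊤ i = 1 := hi.top
  rw [inf_top_eq, inf_top_eq] at h2
  linarith [hσ.self hHA i]

lemma of_disjoint (hσ : IsStrategy H A σ) (hHA : ∀ i, H i ∈ A) {F : 𝓑} (hF : F ∈ A) {i : I}
    (h : Disjoint F (H i)) : σ F i = 0 := by
  rw [← hσ.inf_self hHA hF, h.eq_bot]
  exact (hσ.finAddProb i).bot

lemma inf_apply (hσ : IsStrategy H A σ) (hH : IsPartition H) (hHA : ∀ i, H i ∈ A) {F : 𝓑}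
    (hF : F ∈ A) (i j : I) : σ (F ⊓ H i) j = σ F i * σ (H i) j := by
  by_cases hij : i = j
  · subst hij
    rw [hσ.inf_self hHA hF, hσ.self hHA, mul_one]
  · rw [hσ.of_disjoint hHA (A.infClosed hF (hHA i))
        ((hH.disjoint i j hij).mono_left inf_le_right),
      hσ.of_disjoint hHA (hHA i) (hH.disjoint i j hij), mul_zero]

end IsStrategy

lemma isFinAddProb_disintegrableJoint (hH : IsPartition H)
    (hAL' : AL ≤ completeClosure (range H)) (hπ : IsFinAddProb AL π) (hσ : IsStrategy H A σ)
    (hcont : ∀ F ∈ A, IsAlgContinuous H AL (σ F)) :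
    IsFinAddProb A (disintegrableJoint H AL π σ) := by
  have hI : ∀ F ∈ A, HasIntegral H AL π (σ F) (disintegrableJoint H AL π σ F) := fun F hF =>
    (hcont F hF).hasIntegral hH hAL' hπ
  have hc := fun c => HasIntegral.const (H := H) hπ hπ.top_ne_bot c
  refine ⟨fun F hF => ?_, ?_, fun F hF G hG hFG => ?_⟩
  · simpa using (hI F hF).add_add_nonneg hH hAL' hπ (hc 0) (hc 0) fun i => by
      simpa using (hσ.finAddProb i).nonneg F hF
  · have hT := hI ⊤ BooleanSubalgebra.top_mem
    have h1 : ∀ i, σ ⊤ i = 1 := fun i => (hσ.finAddProb i).top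
    have h2 := hT.add_add_nonneg hH hAL' hπ (hc (-1)) (hc 0) fun i => by simp [h1]
    have h3 := (hT.smul (-1)).add_add_nonneg hH hAL' hπ (hc 1) (hc 0) fun i => by simp [h1]
    linarith
  · have hS := hI _ (BooleanSubalgebra.sup_mem hF hG)
    have h1 : ∀ i, σ (F ⊔ G) i = σ F i + σ G i := fun i =>
      (hσ.finAddProb i).sup_of_disjoint F hF G hG hFG
    have h2 := hS.add_add_nonneg hH hAL' hπ ((hI F hF).smul (-1)) ((hI G hG).smul (-1))
      fun i => by rw [h1]; linarith
    have h3 := (hS.smul (-1)).add_add_nonneg hH hAL' hπ (hI F hF) (hI G hG)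
      fun i => by rw [h1]; linarith
    linarith

/-- The integrand `σ (F ⊓ H i)` is the constant `σ F i` times `σ (H i)`, since both vanish at every
index other than `i`. This is the compatibility that lets the joint be the first layer. -/
lemma disintegrableJoint_inf (hH : IsPartition H) (hHA : ∀ i, H i ∈ A)
    (hAL' : AL ≤ completeClosure (range H)) (hπ : IsFinAddProb AL π) (hσ : IsStrategy H A σ)
    (hcont : ∀ F ∈ A, IsAlgContinuous H AL (σ F)) {F : 𝓑} (hF : F ∈ A) (i : I) :
    disintegrableJoint H AL π σ (F ⊓ H i) = σ F i * disintegrableJoint H AL π σ (H i) := by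
  have hI : ∀ F ∈ A, HasIntegral H AL π (σ F) (disintegrableJoint H AL π σ F) := fun F hF =>
    (hcont F hF).hasIntegral hH hAL' hπ
  have hc := HasIntegral.const (H := H) hπ hπ.top_ne_bot 0
  have hFi := A.infClosed hF (hHA i)
  have key := hσ.inf_apply hH hHA hF i
  have h1 := (hI _ hFi).add_add_nonneg hH hAL' hπ ((hI _ (hHA i)).smul (-σ F i)) hc
    fun j => by rw [key]; linarith
  have h2 := ((hI _ hFi).smul (-1)).add_add_nonneg hH hAL' hπ ((hI _ (hHA i)).smul (σ F i)) hc
    fun j => by rw [key]; linarith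
  linarith

/-! ### Lexicographic full conditional probabilities -/

open Classical in
/-- The conditional probability which is Bayes' rule for `μ` where `μ K > 0`, and `Q` elsewhere. -/
noncomputable def consCond (μ : 𝓑 → ℝ) (Q : 𝓑 → 𝓑 → ℝ) (F K : 𝓑) : ℝ :=
  if 0 < μ K then μ (F ⊓ K) / μ K else Q F K

lemma consCond_of_pos {μ : 𝓑 → ℝ} {Q : 𝓑 → 𝓑 → ℝ} {F K : 𝓑} (h : 0 < μ K) :
    consCond μ Q F K = μ (F ⊓ K) / μ K := if_pos h

lemma consCond_of_eq_zero {μ : 𝓑 → ℝ} {Q : 𝓑 → 𝓑 → ℝ} {F K : 𝓑} (h : μ K = 0) :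
    consCond μ Q F K = Q F K := if_neg h.not_gt

lemma IsFinAddProb.bayes {μ : 𝓑 → ℝ} (hμ : IsFinAddProb A μ) {K : 𝓑} (hK : K ∈ A)
    (h : 0 < μ K) : IsFinAddProb A (fun F => μ (F ⊓ K) / μ K) where
  nonneg F hF := div_nonneg (hμ.nonneg _ (A.infClosed hF hK)) h.le
  top := by rw [top_inf_eq, div_self h.ne']
  sup_of_disjoint F hF G hG hFG := by
    rw [← add_div, inf_sup_right, hμ.sup_of_disjoint _ (A.infClosed hF hK) _
      (A.infClosed hG hK) (hFG.mono inf_le_left inf_le_left)]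

/-- The lexicographic conditional probability of a well-ordered family of finitely additive
probabilities: Bayes' rule for the first one that charges the conditioning event. -/
noncomputable def lexCond {Λ : Type*} (r : Λ → Λ → Prop) [IsWellOrder Λ r] (μ : Λ → 𝓑 → ℝ) (F K : 𝓑) : ℝ :=
  open Classical in
  if h : {l | 0 < μ l K}.Nonempty then
    μ (WellFounded.min (IsWellFounded.wf (r := r)) _ h) (F ⊓ K) /
      μ (WellFounded.min (IsWellFounded.wf (r := r)) _ h) K
  else 0

lemma lexCond_eq {Λ : Type*} (r : Λ → Λ → Prop) [IsWellOrder Λ r] {μ : Λ → 𝓑 → ℝ} {F K : 𝓑}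
    {l : Λ} (hl : 0 < μ l K) (hmin : ∀ m, r m l → ¬ 0 < μ m K) :
    lexCond r μ F K = μ l (F ⊓ K) / μ l K := by
  have h : {l | 0 < μ l K}.Nonempty := ⟨l, hl⟩
  have : WellFounded.min (IsWellFounded.wf (r := r)) _ h = l := by
    rcases trichotomous_of r (WellFounded.min (IsWellFounded.wf (r := r)) _ h) l with h1 | h1 | h1
    · exact absurd (WellFounded.min_mem (IsWellFounded.wf (r := r)) _ h) (hmin _ h1)
    · exact h1
    · exact absurd h1 (WellFounded.not_lt_min (IsWellFounded.wf (r := r)) _ hl)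
  rw [lexCond, dif_pos h, this]

lemma exists_first {Λ : Type*} (r : Λ → Λ → Prop) [IsWellOrder Λ r] {q : Λ → Prop}
    (h : ∃ l, q l) : ∃ l, q l ∧ ∀ m, r m l → ¬ q m :=
  ⟨_, WellFounded.min_mem (IsWellFounded.wf (r := r)) {l | q l} h, fun _ hm hm' =>
    WellFounded.not_lt_min (IsWellFounded.wf (r := r)) _ hm' hm⟩

/-- For the chain rule, let `l` be the first layer charging `K`. If `l` charges `E ⊓ K`, it is also
the first to do so and the Bayes quotients cancel; if not, both sides are zero. -/
lemma isFullCondProb_lexCond {Λ : Type*} (r : Λ → Λ → Prop) [IsWellOrder Λ r]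
    {μ : Λ → 𝓑 → ℝ} (hμ : ∀ l, IsFinAddProb A (μ l))
    (hcov : ∀ K ∈ A, K ≠ ⊥ → ∃ l, 0 < μ l K) : IsFullCondProb A (lexCond r μ) where
  inf_self F hF K hK hK0 := by
    obtain ⟨l, hl, hmin⟩ := exists_first r (hcov K hK hK0)
    rw [lexCond_eq r hl hmin, lexCond_eq r hl hmin, inf_assoc, inf_idem]
  finAddProb K hK hK0 := by
    obtain ⟨l, hl, hmin⟩ := exists_first r (hcov K hK hK0)
    simp only [lexCond_eq r hl hmin]
    exact (hμ l).bayes hK hl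
  chain E hE F hF K hK hK0 hEK0 := by
    obtain ⟨l, hl, hmin⟩ := exists_first r (hcov K hK hK0)
    have hEK := A.infClosed hE hK
    rw [lexCond_eq r hl hmin, lexCond_eq r hl hmin]
    rcases ((hμ l).nonneg _ hEK).eq_or_lt with h0 | h0
    · have h1 : μ l (E ⊓ F ⊓ K) = 0 := le_antisymm
        (h0 ▸ (hμ l).mono (A.infClosed (A.infClosed hE hF) hK) hEK
          (inf_le_inf_right _ inf_le_left))
        ((hμ l).nonneg _ (A.infClosed (A.infClosed hE hF) hK))
      rw [h1, ← h0]
      simp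
    · have hmin' : ∀ m, r m l → ¬ 0 < μ m (E ⊓ K) := fun m hm h =>
        hmin m hm (h.trans_le ((hμ m).mono hEK hK inf_le_right))
      rw [lexCond_eq r h0 hmin', show F ⊓ (E ⊓ K) = E ⊓ F ⊓ K by
        rw [← inf_assoc, inf_comm F]]
      field_simp

/-- Subevents of a `μ`-null event are `μ`-null, so on null events the chain rule involves `Q` alone;
elsewhere it is Bayes' rule, or both sides vanish. -/
lemma isFullCondProb_consCond {μ : 𝓑 → ℝ} {Q : 𝓑 → 𝓑 → ℝ} (hμ : IsFinAddProb A μ)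
    (hQ : IsFullCondProb A Q) : IsFullCondProb A (consCond μ Q) where
  inf_self F hF K hK hK0 := by
    rcases (hμ.nonneg _ hK).eq_or_lt with h0 | h0
    · rw [consCond_of_eq_zero h0.symm, consCond_of_eq_zero h0.symm]
      exact hQ.inf_self F hF K hK hK0
    · rw [consCond_of_pos h0, consCond_of_pos h0, inf_assoc, inf_idem]
  finAddProb K hK hK0 := by
    rcases (hμ.nonneg _ hK).eq_or_lt with h0 | h0
    · simp only [consCond_of_eq_zero h0.symm]
      exact hQ.finAddProb K hK hK0
    · simp only [consCond_of_pos h0]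
      exact hμ.bayes hK h0
  chain E hE F hF K hK hK0 hEK0 := by
    have hEK := A.infClosed hE hK
    rcases (hμ.nonneg _ hK).eq_or_lt with h0 | h0
    · have h1 : μ (E ⊓ K) = 0 :=
        le_antisymm (h0 ▸ hμ.mono hEK hK inf_le_right) (hμ.nonneg _ hEK)
      rw [consCond_of_eq_zero h0.symm, consCond_of_eq_zero h0.symm, consCond_of_eq_zero h1]
      exact hQ.chain E hE F hF K hK hK0 hEK0
    · rw [consCond_of_pos h0, consCond_of_pos h0]
      rcases (hμ.nonneg _ hEK).eq_or_lt with h1 | h1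
      · have h2 : μ (E ⊓ F ⊓ K) = 0 := le_antisymm
          (h1 ▸ hμ.mono (A.infClosed (A.infClosed hE hF) hK) hEK
            (inf_le_inf_right _ inf_le_left))
          (hμ.nonneg _ (A.infClosed (A.infClosed hE hF) hK))
        rw [h2, ← h1]
        simp
      · rw [consCond_of_pos h1, show F ⊓ (E ⊓ K) = E ⊓ F ⊓ K by rw [← inf_assoc, inf_comm F]]
        field_simp

lemma consCond_eq {μ : 𝓑 → ℝ} {Q : 𝓑 → 𝓑 → ℝ} (hμ : IsFinAddProb A μ) {F K : 𝓑} (hK : K ∈ A)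
    {s : ℝ} (h : μ (F ⊓ K) = s * μ K) (hQ : μ K = 0 → Q F K = s) : consCond μ Q F K = s := by
  rcases (hμ.nonneg _ hK).eq_or_lt with h0 | h0
  · rw [consCond_of_eq_zero h0.symm, hQ h0.symm]
  · rw [consCond_of_pos h0, h, mul_div_cancel_right₀ _ h0.ne']

/-! ### Two-valued probabilities -/

open Classical in
/-- The two-valued probability of the events implied by `U`-almost all of the atoms `a`. -/
noncomputable def ultraProb {ι : Type*} (U : Ultrafilter ι) (a : ι → 𝓑) (F : 𝓑) : ℝ :=
  if ∀ᶠ i in (U : Filter ι), a i ≤ F then 1 else 0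

lemma le_or_disjoint_of_isAtom {a F : 𝓑} (ha : IsAtom a) : a ≤ F ∨ Disjoint a F := by
  rcases ha.le_iff.1 (inf_le_left : a ⊓ F ≤ a) with h | h
  · exact Or.inr (disjoint_iff.2 h)
  · exact Or.inl (inf_eq_left.1 h)

lemma ultraProb_eq_one {ι : Type*} {U : Ultrafilter ι} {a : ι → 𝓑} {F : 𝓑}
    (h : ∀ᶠ i in (U : Filter ι), a i ≤ F) : ultraProb U a F = 1 := if_pos h

lemma ultraProb_eq_zero {ι : Type*} {U : Ultrafilter ι} {a : ι → 𝓑} {F : 𝓑}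
    (h : ∀ᶠ i in (U : Filter ι), ¬ a i ≤ F) : ultraProb U a F = 0 :=
  if_neg (Ultrafilter.eventually_not.1 h)

/-- An atom below a join lies below one of its two members, and the ultrafilter decides which events
hold almost everywhere. -/
lemma isFinAddProb_ultraProb {ι : Type*} (U : Ultrafilter ι) {a : ι → 𝓑}
    (ha : ∀ i, IsAtom (a i)) : IsFinAddProb A (ultraProb U a) where
  nonneg F _ := by
    unfold ultraProb
    split_ifs <;> norm_num
  top := ultraProb_eq_one (by simp)
  sup_of_disjoint F _ G _ hFG := by
    have hnot : ∀ i, a i ≤ F → ¬ a i ≤ G := fun i h1 h2 => (ha i).1 (le_bot_iff.1 (hFG h1 h2))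
    rcases U.em (fun i => a i ≤ F) with h | h
    · rw [ultraProb_eq_one h, ultraProb_eq_one (h.mono fun i hi => hi.trans le_sup_left),
        ultraProb_eq_zero (h.mono hnot), add_zero]
    · rw [ultraProb_eq_zero h, zero_add]
      rcases U.em (fun i => a i ≤ G) with h' | h'
      · rw [ultraProb_eq_one h', ultraProb_eq_one (h'.mono fun i hi => hi.trans le_sup_right)]
      · rw [ultraProb_eq_zero h', ultraProb_eq_zero]
        filter_upwards [h, h'] with i h1 h2 h3
        refine (ha i).1 (disjoint_self.1 (Disjoint.mono_right h3 ?_))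
        exact ((le_or_disjoint_of_isAtom (ha i)).resolve_left h1).sup_right
          ((le_or_disjoint_of_isAtom (ha i)).resolve_left h2)

lemma exists_atom_le {K : 𝓑} (hK : K ≠ ⊥) : ∃ a, IsAtom a ∧ a ≤ K :=
  (IsAtomic.eq_bot_or_exists_atom_le K).resolve_left hK

/-! ### Extensions of the strategy and of the joint probability -/

/-- The layers are the `σ(· | H i)`, well-ordered, followed by the point masses at all atoms. The
only strategy layer charging `H i` is its own, which therefore decides there; the atoms ensure that
every nonzero event is charged. -/
lemma exists_isFullCondProb (hH : IsPartition H) (hHA : ∀ i, H i ∈ A) (hσ : IsStrategy H A σ) :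
    ∃ Q, IsFullCondProb A Q ∧ ∀ F ∈ A, ∀ i, Q F (H i) = σ F i := by
  let r : I ⊕ {a : 𝓑 // IsAtom a} → I ⊕ {a : 𝓑 // IsAtom a} → Prop :=
    Sum.Lex WellOrderingRel WellOrderingRel
  have : IsWellOrder _ r := inferInstanceAs (IsWellOrder _ (Sum.Lex _ _))
  let μ : I ⊕ {a : 𝓑 // IsAtom a} → 𝓑 → ℝ :=
    Sum.elim (fun i F => σ F i) fun a => ultraProb (pure ()) fun _ : Unit => a.1
  refine ⟨lexCond r μ, isFullCondProb_lexCond r ?_ ?_, ?_⟩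
  · rintro (i | a)
    · exact hσ.finAddProb i
    · exact isFinAddProb_ultraProb _ fun _ => a.2
  · intro K _ hK0
    obtain ⟨a, ha, haK⟩ := exists_atom_le hK0
    have h1 : μ (Sum.inr ⟨a, ha⟩) K = 1 := ultraProb_eq_one (by simpa using haK)
    exact ⟨Sum.inr ⟨a, ha⟩, h1 ▸ one_pos⟩
  · intro F hF i
    have h1 : μ (Sum.inl i) (H i) = 1 := hσ.self hHA i
    have h2 : μ (Sum.inl i) (F ⊓ H i) = σ F i := hσ.inf_self hHA hF i
    rw [lexCond_eq r (l := Sum.inl i) (h1 ▸ one_pos), h1, h2, div_one]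
    rintro (j | a) hj
    · have hji : j ≠ i := by
        rintro rfl
        exact irrefl_of WellOrderingRel j (Sum.lex_inl_inl.1 hj)
      exact (hσ.of_disjoint hHA (hHA i) (hH.disjoint i j hji.symm)).not_gt
    · exact absurd hj Sum.lex_inr_inl

/-- Placing a probability compatible with the strategy in front of an extension of the strategy
gives an extension of the strategy. -/
lemma consCond_apply_eq {μ : 𝓑 → ℝ} {Q : 𝓑 → 𝓑 → ℝ} (hHA : ∀ i, H i ∈ A)
    (hμ : IsFinAddProb A μ) (hμσ : ∀ F ∈ A, ∀ i, μ (F ⊓ H i) = σ F i * μ (H i))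
    (hQ : ∀ F ∈ A, ∀ i, Q F (H i) = σ F i) {F : 𝓑} (hF : F ∈ A) (i : I) :
    consCond μ Q F (H i) = σ F i :=
  consCond_eq hμ (hHA i) (hμσ F hF i) fun _ => hQ F hF i

lemma consCond_mem_extensions {Q : 𝓑 → 𝓑 → ℝ} (hHA : ∀ i, H i ∈ A) (hPd : IsFinAddProb A Pd)
    (hPdσ : ∀ F ∈ A, ∀ i, Pd (F ⊓ H i) = σ F i * Pd (H i))
    (hQ : IsFullCondProb A Q) (hQσ : ∀ F ∈ A, ∀ i, Q F (H i) = σ F i) :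
    consCond Pd Q ∈ extensions H A Pd σ := by
  refine ⟨isFullCondProb_consCond hPd hQ, fun F _ => ?_, fun F hF i =>
    consCond_apply_eq hHA hPd hPdσ hQσ hF i⟩
  rw [consCond_of_pos (by rw [hPd.top]; exact one_pos), hPd.top, inf_top_eq, div_one]

lemma extensions_nonempty (hH : IsPartition H) (hHA : ∀ i, H i ∈ A) (hσ : IsStrategy H A σ)
    (hPd : IsFinAddProb A Pd) (hPdσ : ∀ F ∈ A, ∀ i, Pd (F ⊓ H i) = σ F i * Pd (H i)) :
    (extensions H A Pd σ).Nonempty := by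
  obtain ⟨Q, hQ, hQσ⟩ := exists_isFullCondProb hH hHA hσ
  exact ⟨_, consCond_mem_extensions hHA hPd hPdσ hQ hQσ⟩

/-- An extension whose conditional probabilities are governed by `σ(· | H i)` on the events that
are null for `Pd` and are charged by it. -/
lemma exists_extension_strategy (hH : IsPartition H) (hHA : ∀ i, H i ∈ A)
    (hσ : IsStrategy H A σ) (hPd : IsFinAddProb A Pd)
    (hPdσ : ∀ F ∈ A, ∀ i, Pd (F ⊓ H i) = σ F i * Pd (H i)) {F K : 𝓑} (hK : Pd K = 0) {i : I}
    (hi : 0 < σ K i) : ∃ P ∈ extensions H A Pd σ, P F K = σ (F ⊓ K) i / σ K i := by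
  obtain ⟨Q, hQ, hQσ⟩ := exists_isFullCondProb hH hHA hσ
  refine ⟨_, consCond_mem_extensions hHA hPd hPdσ
    (isFullCondProb_consCond (hσ.finAddProb i) hQ)
    (fun G hG j => consCond_apply_eq hHA (hσ.finAddProb i)
      (fun G hG j => hσ.inf_apply hH hHA hG j i) hQσ hG j), ?_⟩
  rw [consCond_of_eq_zero hK, consCond_of_pos (μ := fun F => σ F i) hi]

/-- If some `H i` is compatible with `Fᶜ ⊓ K` but does not charge `K`, or charges `K` but not
`F ⊓ K`, then some extension gives `F` probability zero given `K`. -/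
lemma exists_extension_eq_zero (hH : IsPartition H) (hHA : ∀ i, H i ∈ A)
    (hσ : IsStrategy H A σ) (hPd : IsFinAddProb A Pd)
    (hPdσ : ∀ F ∈ A, ∀ i, Pd (F ⊓ H i) = σ F i * Pd (H i)) {F K : 𝓑}
    (hKA : K ∈ A) (hK : Pd K = 0) {i : I} (hi : H i ⊓ Fᶜ ⊓ K ≠ ⊥)
    (h0 : 0 < σ K i → σ (F ⊓ K) i = 0) : ∃ P ∈ extensions H A Pd σ, P F K = 0 := by
  rcases ((hσ.finAddProb i).nonneg K hKA).eq_or_lt with hσK | hσK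
  · obtain ⟨Q, hQ, hQσ⟩ := exists_isFullCondProb hH hHA hσ
    obtain ⟨a, ha, hai⟩ := exists_atom_le hi
    simp only [le_inf_iff] at hai
    obtain ⟨⟨haH, haF⟩, haK⟩ := hai
    have hnot : ∀ G, Disjoint a G → ¬ a ≤ G := fun G h h' =>
      ha.1 (disjoint_self.1 (h.mono_right h'))
    let δ : 𝓑 → ℝ := ultraProb (pure ()) fun _ : Unit => a
    have hδ : IsFinAddProb A δ := isFinAddProb_ultraProb _ fun _ => ha
    have hδK : δ K = 1 := ultraProb_eq_one (by simpa using haK)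
    have hδ0 : ∀ G, Disjoint a G → δ G = 0 := fun G h =>
      ultraProb_eq_zero (by simpa using hnot G h)
    -- Layers: `Pd`, `σ(· | H i)`, `δ`, `Q`. The point mass need not be compatible with `σ` on `H
    -- i`, but the layer before it already decides there; on every other `H j` it vanishes.
    refine ⟨_, consCond_mem_extensions hHA hPd hPdσ
      (isFullCondProb_consCond (hσ.finAddProb i) (isFullCondProb_consCond hδ hQ))
      (fun G hG j => consCond_eq (hσ.finAddProb i) (hHA j)
        (hσ.inf_apply hH hHA hG j i) fun hj => ?_), ?_⟩
    · have hij : i ≠ j := by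
        rintro rfl
        exact one_ne_zero ((hσ.self hHA i).symm.trans hj)
      have hdis := (hH.disjoint i j hij).mono_left haH
      rw [consCond_of_eq_zero (hδ0 _ hdis), hQσ G hG]
    · rw [consCond_of_eq_zero hK, consCond_of_eq_zero (μ := fun F => σ F i) hσK.symm,
        consCond_of_pos (hδK ▸ one_pos), hδ0, zero_div]
      exact (disjoint_compl_left.mono_left haF).mono_right inf_le_left
  · obtain ⟨P, hP, h⟩ := exists_extension_strategy (F := F) hH hHA hσ hPd hPdσ hK hσK
    exact ⟨P, hP, by rw [h, h0 hσK, zero_div]⟩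

/-- If infinitely many `H i` are compatible with `Fᶜ ⊓ K`, then some extension gives `F`
probability zero given `K`. -/
lemma exists_extension_eq_zero_of_infinite (hH : IsPartition H) (hHA : ∀ i, H i ∈ A)
    (hσ : IsStrategy H A σ) (hPd : IsFinAddProb A Pd)
    (hPdσ : ∀ F ∈ A, ∀ i, Pd (F ⊓ H i) = σ F i * Pd (H i)) {F K : 𝓑} (hK : Pd K = 0)
    {s : Set I} (hs : s.Infinite) (hi : ∀ i ∈ s, H i ⊓ Fᶜ ⊓ K ≠ ⊥) :
    ∃ P ∈ extensions H A Pd σ, P F K = 0 := by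
  obtain ⟨Q, hQ, hQσ⟩ := exists_isFullCondProb hH hHA hσ
  have := hs.to_subtype
  choose a ha hai using fun i : s => exists_atom_le (hi i i.2)
  simp only [le_inf_iff] at hai
  have hnot : ∀ i G, Disjoint (a i) G → ¬ a i ≤ G := fun i G h h' =>
    (ha i).1 (disjoint_self.1 (h.mono_right h'))
  let ν : 𝓑 → ℝ := ultraProb (hyperfilter s) a
  have hν : IsFinAddProb A ν := isFinAddProb_ultraProb _ ha
  have hνK : ν K = 1 := ultraProb_eq_one (Eventually.of_forall fun i => (hai i).2)
  have hν0 : ∀ G, (∀ᶠ i in (hyperfilter s : Filter s), Disjoint (a i) G) → ν G = 0 :=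
    fun G h => ultraProb_eq_zero (h.mono fun i hi => hnot i G hi)
  -- The atom `a i` lies in `H i`, so at most one index contributes to `H j`, and the hyperfilter
  -- ignores finite sets. Compatibility with `σ` then reads `0 = 0`.
  have hνH : ∀ j G, ν (G ⊓ H j) = 0 := by
    refine fun j G => hν0 _ (hyperfilter_le_cofinite ?_)
    have hfin : {i : s | (i : I) = j}.Finite :=
      Set.Subsingleton.finite fun x hx y hy => Subtype.ext (hx.trans hy.symm)
    filter_upwards [hfin.compl_mem_cofinite] with i hij
    exact ((hH.disjoint i j hij).mono_left (hai i).1.1).mono_right inf_le_right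
  refine ⟨_, consCond_mem_extensions hHA hPd hPdσ (isFullCondProb_consCond hν hQ)
    (fun G hG j => consCond_apply_eq hHA hν (fun G hG j => ?_) hQσ hG j), ?_⟩
  · rw [hνH, ← top_inf_eq (H j), hνH, mul_zero]
  · rw [consCond_of_eq_zero hK, consCond_of_pos (hνK ▸ one_pos), hν0, zero_div]
    exact Eventually.of_forall fun i =>
      (disjoint_compl_left.mono_left (hai i).1.2).mono_right inf_le_left

/-! ### Values common to all extensions -/

lemma IsFullCondProb.eq_one {P : 𝓑 → 𝓑 → ℝ} (hP : IsFullCondProb A P) {F K : 𝓑} (hF : F ∈ A)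
    (hK : K ∈ A) (hK0 : K ≠ ⊥) (h : F ⊓ K = K) : P F K = 1 := by
  -- Writing `K` as `⊤ ⊓ K` allows `inf_self` to be read backwards, from `P K K` to `P ⊤ K`.
  rw [hP.inf_self F hF K hK hK0, h, ← top_inf_eq K,
    show P (⊤ ⊓ K) (⊤ ⊓ K) = P (⊤ ⊓ K) K by rw [top_inf_eq],
    ← hP.inf_self ⊤ BooleanSubalgebra.top_mem K hK hK0]
  exact (hP.finAddProb K hK hK0).top

/-- The chain rule at `⊤` reads `Pd (F ⊓ K) = Pd K * P F K`, which leaves no freedom. -/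
lemma eq_div_of_mem_extensions {P : 𝓑 → 𝓑 → ℝ} (hP : P ∈ extensions H A Pd σ) {F K : 𝓑}
    (hF : F ∈ A) (hK : K ∈ A) (hK0 : K ≠ ⊥) (hpos : 0 < Pd K) :
    P F K = Pd (F ⊓ K) / Pd K := by
  have hT : (⊤ : 𝓑) ≠ ⊥ := fun h => hK0 (le_bot_iff.1 (h ▸ le_top))
  have := hP.1.chain K hK F hF ⊤ BooleanSubalgebra.top_mem hT (by rwa [inf_top_eq])
  rw [hP.2.1 _ (A.infClosed hK hF), hP.2.1 _ hK, inf_top_eq, inf_comm] at this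
  rw [this, mul_div_cancel_left₀ _ hpos.ne']

lemma eq_div_inf_of_mem_extensions {P : 𝓑 → 𝓑 → ℝ} (hH : IsPartition H) (hHA : ∀ i, H i ∈ A)
    (hP : P ∈ extensions H A Pd σ) {F K : 𝓑} (hF : F ∈ A) (hK : K ∈ A) {i : I}
    (hKi : H i ⊓ K ≠ ⊥) (hpos : 0 < σ K i) :
    P F (H i ⊓ K) = σ (F ⊓ K) i / σ K i := by
  have := hP.1.chain K hK F hF (H i) (hHA i) (hH.ne_bot i) (by rwa [inf_comm])
  rw [hP.2.2 _ (A.infClosed hK hF), hP.2.2 _ hK, inf_comm K F, inf_comm K (H i)] at this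
  rw [this, mul_div_cancel_left₀ _ hpos.ne']

/-- An `H i` that meets `Fᶜ ⊓ K` has its index in `I₂` or `I₃`, so with `I₃` empty nothing of `Fᶜ ⊓
K` is left outside `D`. -/
lemma inf_le_sup_of_I₃_eq_empty (hH : IsPartition H) {F K : 𝓑} (h3 : I₃ H F K = ∅)
    {D : 𝓑} (hD : ∀ i ∈ I₂ H F K, H i ≤ D) : Fᶜ ⊓ K ≤ D := by
  rw [← disjoint_compl_right_iff]
  by_contra h
  obtain ⟨i, hi⟩ := hH.exists_inf_ne_bot fun h' => h (disjoint_iff.2 h')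
  have h1 : H i ⊓ Fᶜ ⊓ K ≠ ⊥ := fun h' => hi <| by
    rw [← inf_assoc, ← inf_assoc, h', bot_inf_eq]
  have h2 : H i ⊓ F ⊓ K ≠ ⊥ := fun h' => (h3 ▸ (show i ∈ I₃ H F K from ⟨h', h1⟩) : i ∈ (∅ : Set I))
  exact hi (((disjoint_compl_right (a := D)).mono (hD i ⟨h2, h1⟩) inf_le_right).eq_bot)

/-- The estimate goes through `Fᶜ` because `K` itself may extend beyond the finitely many `H i` of
`I₂`, whereas `Fᶜ ⊓ K` does not. -/
lemma RatioCase.le_of_mem_extensions {P : 𝓑 → 𝓑 → ℝ} (hH : IsPartition H) (hHA : ∀ i, H i ∈ A)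
    (hP : P ∈ extensions H A Pd σ) {F K : 𝓑} (hF : F ∈ A) (hK : K ∈ A) (hK0 : K ≠ ⊥)
    (hR : RatioCase H σ F K) {m : ℝ} (hm1 : m ≤ 1)
    (hm : ∀ i ∈ I₂ H F K, m ≤ σ (F ⊓ K) i / σ K i) : m ≤ P F K := by
  obtain ⟨-, h3, hfin, hpos⟩ := hR
  have hPK := hP.1.finAddProb K hK hK0
  have hFc := BooleanSubalgebra.compl_mem hF
  have hd : (hfin.toFinset : Set I).PairwiseDisjoint H := fun i _ j _ hij => hH.disjoint i j hij
  obtain ⟨hDA, hsum⟩ := hPK.sum_inf hFc hfin.toFinset (fun i _ => hHA i) hd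
  have hsum' := (hPK.sum_inf BooleanSubalgebra.top_mem hfin.toFinset (fun i _ => hHA i) hd).2
  set D := hfin.toFinset.sup H
  have hle : Fᶜ ⊓ K ≤ D := inf_le_sup_of_I₃_eq_empty hH h3 fun i hi =>
    Finset.le_sup (f := H) (hfin.mem_toFinset.2 hi)
  have hPD : P Fᶜ K = P (Fᶜ ⊓ D) K := by
    rw [hP.1.inf_self _ hFc K hK hK0, hP.1.inf_self _ (A.infClosed hFc hDA) K hK hK0,
      inf_right_comm, inf_eq_left.2 hle]
  -- By the chain rule the left side is `P (H i) K * P Fᶜ (H i ⊓ K)`, and the last factor is one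
  -- minus a ratio that is at least `m`.
  have hbound : ∀ i ∈ hfin.toFinset, P (Fᶜ ⊓ H i) K ≤ (1 - m) * P (⊤ ⊓ H i) K := by
    intro i hi
    rw [hfin.mem_toFinset] at hi
    have hKi : H i ⊓ K ≠ ⊥ := fun h => hi.1 <| by rw [inf_right_comm, h, bot_inf_eq]
    rw [inf_comm, hP.1.chain (H i) (hHA i) _ hFc K hK hK0 hKi, top_inf_eq, mul_comm]
    refine mul_le_mul_of_nonneg_right ?_ (hPK.nonneg _ (hHA i))
    have h1 := (hP.1.finAddProb _ (A.infClosed (hHA i) hK) hKi).inf_add_inf_compl hF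
      BooleanSubalgebra.top_mem
    have h2 := (hP.1.finAddProb _ (A.infClosed (hHA i) hK) hKi).top
    simp only [inf_top_eq] at h1
    have h3 := hm i hi
    rw [← eq_div_inf_of_mem_extensions hH hHA hP hF hK hKi (hpos i hi)] at h3
    linarith
  have h1 := hPK.inf_add_inf_compl hF BooleanSubalgebra.top_mem
  have h2 := hPK.top
  simp only [inf_top_eq] at h1
  have h4 := Finset.sum_le_sum hbound
  rw [← Finset.mul_sum, hsum, hsum', top_inf_eq, ← hPD] at h4
  -- `P Fᶜ K ≤ (1 - m) * P D K ≤ 1 - m`; the last inequality needs `m ≤ 1`.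
  nlinarith [hPK.le_one hDA]

/-- Outside the ratio case, some extension gives `F` probability zero given the null event
`K`. -/
lemma exists_extension_eq_zero_of_not_ratioCase (hH : IsPartition H) (hHA : ∀ i, H i ∈ A)
    (hσ : IsStrategy H A σ) (hPd : IsFinAddProb A Pd)
    (hPdσ : ∀ F ∈ A, ∀ i, Pd (F ⊓ H i) = σ F i * Pd (H i)) {F K : 𝓑} (hF : F ∈ A) (hKA : K ∈ A)
    (hFK : F ⊓ K ≠ K) (hK : Pd K = 0) (hR : ¬ RatioCase H σ F K) :
    ∃ P ∈ extensions H A Pd σ, P F K = 0 := by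
  by_cases h3 : I₃ H F K = ∅
  · have h2 : (I₂ H F K).Nonempty := by
      by_contra h
      rw [not_nonempty_iff_eq_empty] at h
      -- With `I₂` and `I₃` both empty, `K` would imply `F`.
      have : Fᶜ ⊓ K ≤ ⊥ := inf_le_sup_of_I₃_eq_empty hH h3 (by simp [h])
      refine hFK (inf_eq_right.2 ?_)
      exact disjoint_compl_left_iff.1 (disjoint_iff_inf_le.2 this)
    by_cases hfin : (I₂ H F K).Finite
    · have : ∃ i ∈ I₂ H F K, ¬ 0 < σ K i := by
        by_contra! h
        exact hR ⟨h2, h3, hfin, h⟩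
      obtain ⟨i, hi, hi0⟩ := this
      exact exists_extension_eq_zero hH hHA hσ hPd hPdσ hKA hK hi.2 fun h => absurd h hi0
    · exact exists_extension_eq_zero_of_infinite hH hHA hσ hPd hPdσ hK hfin fun i hi => hi.2
  · obtain ⟨i, hi⟩ := nonempty_iff_ne_empty.2 h3
    -- For `i` in `I₃` the event `F ⊓ K` misses `H i`, so `σ(· | H i)` does not charge it.
    refine exists_extension_eq_zero hH hHA hσ hPd hPdσ hKA hK hi.2 fun _ => ?_
    refine hσ.of_disjoint hHA (A.infClosed hF hKA) ?_
    rw [disjoint_comm, disjoint_iff, ← inf_assoc]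
    exact hi.1

lemma RatioCase.exists_isLeast (hσ : IsStrategy H A σ) {F K : 𝓑} (hF : F ∈ A) (hK : K ∈ A)
    (hR : RatioCase H σ F K) :
    ∃ i ∈ I₂ H F K, σ (F ⊓ K) i / σ K i ≤ 1 ∧
      IsLeast ((fun i => σ (F ⊓ K) i / σ K i) '' I₂ H F K) (σ (F ⊓ K) i / σ K i) := by
  obtain ⟨i, hi, hmin⟩ := exists_min_image _ (fun i => σ (F ⊓ K) i / σ K i) hR.2.2.1 hR.1
  refine ⟨i, hi, div_le_one_of_le₀ ?_ ((hσ.finAddProb i).nonneg K hK), ⟨i, hi, rfl⟩, ?_⟩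
  · exact (hσ.finAddProb i).mono (A.infClosed hF hK) hK inf_le_right
  · rintro _ ⟨j, hj, rfl⟩
    exact hmin j hj

lemma isLeast_lowerEnvelope {α : Type*} {𝒬 : Set (α → α → ℝ)} {F K : α} {m : ℝ} (hm : ∃ P ∈ 𝒬, P F K = m)
    (hle : ∀ P ∈ 𝒬, m ≤ P F K) :
    IsLeast ((fun P => P F K) '' 𝒬) (lowerEnvelope 𝒬 F K) ∧ lowerEnvelope 𝒬 F K = m := by
  have : IsLeast ((fun P => P F K) '' 𝒬) m := ⟨hm, by rintro _ ⟨P, hP, rfl⟩; exact hle P hP⟩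
  have h : lowerEnvelope 𝒬 F K = m := this.csInf_eq
  exact ⟨h ▸ this, h⟩

end Envelope

theorem theorem3 {𝓑 I J : Type*} [CompleteAtomicBooleanAlgebra 𝓑]
    (H : I → 𝓑) (E : J → 𝓑) (hH : Envelope.IsPartition H) (hE : Envelope.IsPartition E)
    (AL AE A : BooleanSubalgebra 𝓑)
    (hAL : BooleanSubalgebra.closure (Set.range H) ≤ AL)
    (hAL' : AL ≤ Envelope.completeClosure (Set.range H))
    (hAE : BooleanSubalgebra.closure (Set.range E) ≤ AE)
    (hAE' : AE ≤ Envelope.completeClosure (Set.range E))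
    (hA : BooleanSubalgebra.closure ((AL : Set 𝓑) ∪ (AE : Set 𝓑)) ≤ A)
    (hA' : A ≤ Envelope.completeClosure ((AL : Set 𝓑) ∪ (AE : Set 𝓑)))
    (π : 𝓑 → ℝ) (hπ : Envelope.IsFinAddProb AL π)
    (σ : 𝓑 → I → ℝ) (hσ : Envelope.IsStrategy H A σ)
    (hcont : ∀ F ∈ A, Envelope.IsAlgContinuous H AL (σ F)) :
    -- the integrals that define the disintegrable joint probability exist
    (∀ F ∈ A, Envelope.IsSIntegrable H AL π (σ F)) ∧
    ∀ Pd : 𝓑 → ℝ, Pd = Envelope.disintegrableJoint H AL π σ →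
    ∀ 𝓟 : Set (𝓑 → 𝓑 → ℝ), 𝓟 = Envelope.extensions H A Pd σ →
    ∀ F ∈ A, ∀ K ∈ A, K ≠ ⊥ →
      -- the lower envelope is attained
      IsLeast ((fun P => P F K) '' 𝓟) (Envelope.lowerEnvelope 𝓟 F K) ∧
      (F ⊓ K = K → Envelope.lowerEnvelope 𝓟 F K = 1) ∧
      (F ⊓ K ≠ K →
        (0 < Pd K → Envelope.lowerEnvelope 𝓟 F K = Pd (F ⊓ K) / Pd K) ∧
        (Pd K = 0 →
          (Envelope.RatioCase H σ F K →
            IsLeast ((fun i => σ (F ⊓ K) i / σ K i) '' Envelope.I₂ H F K)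
              (Envelope.lowerEnvelope 𝓟 F K)) ∧
          (¬ Envelope.RatioCase H σ F K → Envelope.lowerEnvelope 𝓟 F K = 0))) := by
  have hHAL : ∀ i, H i ∈ AL := fun i => hAL (BooleanSubalgebra.subset_closure ⟨i, rfl⟩)
  have hHA : ∀ i, H i ∈ A := fun i =>
    hA (BooleanSubalgebra.subset_closure (Or.inl (hHAL i)))
  have hPd := Envelope.isFinAddProb_disintegrableJoint hH hAL' hπ hσ hcont
  have hPdσ : ∀ F ∈ A, ∀ i, _ := fun F hF i =>
    Envelope.disintegrableJoint_inf hH hHA hAL' hπ hσ hcont hF i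
  refine ⟨fun F hF => ?_, ?_⟩
  · have := ((hcont F hF).hasIntegral hH hAL' hπ).lowerIntegral_eq_and_upperIntegral_eq hH hAL' hπ
      (hcont F hF).bounded
    exact this.2.symm
  rintro Pd rfl 𝓟 rfl F hF K hK hK0
  by_cases hFK : F ⊓ K = K
  · obtain ⟨P₀, hP₀⟩ := Envelope.extensions_nonempty hH hHA hσ hPd hPdσ
    have h1 : ∀ P ∈ Envelope.extensions H A (Envelope.disintegrableJoint H AL π σ) σ, P F K = 1 :=
      fun P hP => hP.1.eq_one hF hK hK0 hFK
    obtain ⟨hl, he⟩ := Envelope.isLeast_lowerEnvelope ⟨P₀, hP₀, h1 P₀ hP₀⟩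
      fun P hP => (h1 P hP).ge
    exact ⟨hl, fun _ => he, fun h => absurd hFK h⟩
  rcases (hPd.nonneg K hK).eq_or_lt with h0 | h0
  · by_cases hR : Envelope.RatioCase H σ F K
    -- An index of least ratio supplies the layer behind the joint, which attains the lower bound.
    · obtain ⟨i, hi, hi1, hmin⟩ := hR.exists_isLeast hσ hF hK
      obtain ⟨hl, he⟩ := Envelope.isLeast_lowerEnvelope
        (Envelope.exists_extension_strategy (F := F) hH hHA hσ hPd hPdσ h0.symm (hR.2.2.2 i hi))
        fun P hP => hR.le_of_mem_extensions hH hHA hP hF hK hK0 hi1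
          fun j hj => hmin.2 ⟨j, hj, rfl⟩
      exact ⟨hl, fun h => absurd h hFK, fun _ => ⟨fun h => absurd h0 h.ne,
        fun _ => ⟨fun _ => he ▸ hmin, fun h => absurd hR h⟩⟩⟩
    · obtain ⟨hl, he⟩ := Envelope.isLeast_lowerEnvelope
        (Envelope.exists_extension_eq_zero_of_not_ratioCase hH hHA hσ hPd hPdσ hF hK hFK
          h0.symm hR)
        fun P hP => (hP.1.finAddProb K hK hK0).nonneg F hF
      exact ⟨hl, fun h => absurd h hFK, fun _ => ⟨fun h => absurd h0 h.ne,
        fun _ => ⟨fun h => absurd h hR, fun _ => he⟩⟩⟩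
  · obtain ⟨P₀, hP₀⟩ := Envelope.extensions_nonempty hH hHA hσ hPd hPdσ
    have h1 := fun P hP => Envelope.eq_div_of_mem_extensions (P := P)
      (Pd := Envelope.disintegrableJoint H AL π σ) (H := H) (σ := σ) hP hF hK hK0 h0
    obtain ⟨hl, he⟩ := Envelope.isLeast_lowerEnvelope ⟨P₀, hP₀, h1 P₀ hP₀⟩
      fun P hP => (h1 P hP).ge
    exact ⟨hl, fun h => absurd h hFK, fun _ => ⟨fun _ => he, fun h => absurd h h0.ne'⟩⟩
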